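/- Let $E$ be a locally convex Hausdorff space over $\mathbb{C}$ that is locally complete, i.e. for every closed bounded absolutely convex set $D\subset E$ the space $E_D=\bigcup_{n\in\mathbb{N}} nD$, normed by the gauge functional of $D$, is a Banach space. Let $z\in\mathbb{C}^d$, $R\in(0,\infty]^d$ and let $\mathbb{D}_R(z)=\{w\in\mathbb{C}^d : |w_k-z_k|<R_k \text{ for all } k\}$ be the corresponding polydisc. For an open set $\Omega\subset\mathbb{C}^d$ let $\mathcal{O}(\Omega,E)$ be the space of all functions $f\colon\Omega\to E$ that are continuously partially differentiable in the real sense (as functions on an open subset of $\mathbb{R}^{2d}$) and whose complex partial derivatives $\partial^\beta f(w)=\partial_1^{\beta_1}\cdots\partial_d^{\beta_d}f(w)$, formed as limits of difference quotients in $E$, exist in $E$ for all $w\in\Omega$ and $\beta\in\mathbb{N}_0^d$. Equip it with the compact-open topology, i.e. the topology given by the seminorms $f\mapsto\sup_{w\in K}p(f(w))$, $K\subset\Omega$ compact, $p$ a continuous seminorm on $E$, and put $\mathcal{O}(\Omega)=\mathcal{O}(\Omega,\mathbb{C})$. The tensor product $\mathcal{O}(\Omega)\otimes E$ is mapped into $\mathcal{O}(\Omega,E)$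 by the linear map with $g\otimes e\mapsto[w\mapsto g(w)e]$. Then (the image of) $\mathcal{O}(\mathbb{D}_R(z))\otimes E$ is sequentially dense in $\mathcal{O}(\mathbb{D}_R(z),E)$, i.e. every $f\in\mathcal{O}(\mathbb{D}_R(z),E)$ is the limit in $\mathcal{O}(\mathbb{D}_R(z),E)$ of a sequence in it; and for every $f\in\mathcal{O}(\mathbb{D}_R(z),E)$ $$f=\sum_{\beta\in\mathbb{N}_0^d}\frac{\partial^\beta f(z)}{\beta!}\,(\cdot-z)^\beta,$$ where the series converges (unconditionally, i.e. along the net of finite subsets of $\mathbb{N}_0^d$) in $\mathcal{O}(\mathbb{D}_R(z),E)$. -/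

import Mathlib

open Filter Topology TopologicalSpace
open scoped ENNReal TensorProduct

noncomputable section

/-! ### Locally complete spaces -/

section LocallyComplete

variable {E : Type*} [AddCommGroup E] [Module ℂ E]

/-- The space `E_D = ⋃ₙ n D` attached to a disk `D`. -/
def diskSpan (D : Set E) : Set E := {x | ∃ n : ℕ, ∃ y ∈ D, x = (n : ℂ) • y}

/-- A disk: a (nonempty) bounded, absolutely convex subset. -/
structure IsDisk [TopologicalSpace E] (D : Set E) : Prop where
  nonempty : D.Nonempty
  bounded : Bornology.IsVonNBounded ℂ D
  balanced : Balanced ℂ D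
  convex : Convex ℝ D

/-- `E` is locally complete: for every closed disk `D` the space `E_D`, normed by the gauge
functional of `D`, is a Banach space, i.e. every sequence in `E_D` that is Cauchy for the gauge
converges in `E_D` for the gauge. -/
def IsLocallyComplete (E : Type*) [AddCommGroup E] [Module ℂ E] [TopologicalSpace E] : Prop :=
  ∀ D : Set E, IsDisk D → IsClosed D →
    ∀ u : ℕ → E, (∀ n, u n ∈ diskSpan D) →
      (∀ ε > 0, ∃ N, ∀ m ≥ N, ∀ n ≥ N, gauge D (u m - u n) < ε) →
      ∃ x ∈ diskSpan D, ∀ ε > 0, ∃ N, ∀ n ≥ N, gauge D (u n - x) < ε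

end LocallyComplete

/-! ### Directional and partial derivatives -/

section Derivatives

/-- `e` is the derivative of `F` at `z` in direction `v` over `𝕜`: it is the limit in `E` of
`(F (z + h v) - F z) / h` as `h → 0`, `h ∈ 𝕜 \ {0}`. -/
def HasDirDeriv (𝕜 : Type*) [NormedField 𝕜] {V E : Type*} [AddCommGroup V] [Module 𝕜 V]
    [AddCommGroup E] [Module 𝕜 E] [TopologicalSpace E] (F : V → E) (e : E) (z v : V) : Prop :=
  Tendsto (fun h : 𝕜 => h⁻¹ • (F (z + h • v) - F z)) (𝓝[≠] 0) (𝓝 e)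

variable {d : ℕ} {E : Type*} [AddCommGroup E] [Module ℂ E] [TopologicalSpace E]

/-- The complex partial derivative in the `j`-th variable (meaningful where it exists). -/
def partialC (j : Fin d) (F : (Fin d → ℂ) → E) (z : Fin d → ℂ) : E :=
  limUnder (𝓝[≠] (0 : ℂ)) fun h => h⁻¹ • (F (z + h • (Pi.single j 1 : Fin d → ℂ)) - F z)

/-- `iterPartial [j₁, …, jₘ] F = ∂_{j₁} (⋯ (∂_{jₘ} F))`. -/
def iterPartial : List (Fin d) → ((Fin d → ℂ) → E) → (Fin d → ℂ) → E
  | [], F => F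
  | j :: L, F => partialC j (iterPartial L F)

/-- All the successive derivatives in `iterPartial L F` exist in `E` at every point of `Ω`. -/
def PartialsExist (Ω : Set (Fin d → ℂ)) : List (Fin d) → ((Fin d → ℂ) → E) → Prop
  | [], _ => True
  | j :: L, F => PartialsExist Ω L F ∧
      ∀ z ∈ Ω, ∃ e, HasDirDeriv ℂ (iterPartial L F) e z (Pi.single j 1)

/-- The list `[0, …, 0, 1, …, 1, …]` with `β j` entries equal to `j`, so that
`iterPartial (multiIndexList β)` is `∂^β = ∂₁^{β₁} ⋯ ∂_d^{β_d}`. -/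
def multiIndexList (β : Fin d → ℕ) : List (Fin d) :=
  (List.finRange d).flatMap fun j => List.replicate (β j) j

/-- The complex partial derivative `∂^β F` of multi-index `β`. -/
def partialMulti (β : Fin d → ℕ) (F : (Fin d → ℂ) → E) : (Fin d → ℂ) → E :=
  iterPartial (multiIndexList β) F

/-- The first order real partial derivatives of `F`, as a function on `ℂ^d ≅ ℝ^{2d}`, exist in `E`
at every point of `Ω` and are continuous on `Ω`. -/
def HasContRealPartials (Ω : Set (Fin d → ℂ)) (F : (Fin d → ℂ) → E) : Prop :=
  ∀ j : Fin d, ∀ c ∈ ({1, Complex.I} : Set ℂ), ∃ G : (Fin d → ℂ) → E, ContinuousOn G Ω ∧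
    ∀ z ∈ Ω, HasDirDeriv ℝ F (G z) z (Pi.single j c)

open Classical in
/-- Extension by `0` of a function on an open set; only used to differentiate it at points of
the open set. -/
def zeroExt {Ω : Opens (Fin d → ℂ)} (f : Ω → E) (w : Fin d → ℂ) : E :=
  if h : w ∈ Ω then f ⟨w, h⟩ else 0

end Derivatives

/-! ### Closure properties, needed for the space of holomorphic functions -/

set_option linter.unusedSectionVars false

section Lemmas

variable {d : ℕ}
variable {E : Type*} [AddCommGroup E] [Module ℂ E] [TopologicalSpace E]
variable {E' : Type*} [AddCommGroup E'] [Module ℂ E'] [TopologicalSpace E']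

theorem zeroExt_of_mem {Ω : Opens (Fin d → ℂ)} (f : Ω → E) {w : Fin d → ℂ} (h : w ∈ Ω) :
    zeroExt f w = f ⟨w, h⟩ := by
  simp [zeroExt, h]

theorem eventually_mem_line {𝕜 : Type*} [NormedField 𝕜] {V : Type*} [AddCommGroup V] [Module 𝕜 V]
    [TopologicalSpace V] [ContinuousAdd V] [ContinuousSMul 𝕜 V] {Ω : Set V} (hΩ : IsOpen Ω)
    {z : V} (hz : z ∈ Ω) (v : V) : ∀ᶠ h : 𝕜 in 𝓝[≠] 0, z + h • v ∈ Ω := by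
  have hc : Continuous fun h : 𝕜 => z + h • v := by fun_prop
  have : Tendsto (fun h : 𝕜 => z + h • v) (𝓝 0) (𝓝 z) := by
    simpa using hc.tendsto 0
  exact (this.mono_left nhdsWithin_le_nhds) (hΩ.mem_nhds hz)

theorem HasDirDeriv.congr_on {𝕜 : Type*} [NormedField 𝕜] {V : Type*} [AddCommGroup V] [Module 𝕜 V]
    [TopologicalSpace V] [ContinuousAdd V] [ContinuousSMul 𝕜 V] {W : Type*} [AddCommGroup W]
    [Module 𝕜 W] [TopologicalSpace W] {Ω : Set V} (hΩ : IsOpen Ω)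
    {F G : V → W} {e : W} {z v : V} (hz : z ∈ Ω) (hF : HasDirDeriv 𝕜 F e z v)
    (h : Set.EqOn G F Ω) : HasDirDeriv 𝕜 G e z v := by
  refine Tendsto.congr' ?_ hF
  filter_upwards [eventually_mem_line (𝕜 := 𝕜) hΩ hz v] with t ht
  rw [h ht, h hz]

theorem HasDirDeriv.add {𝕜 : Type*} [NormedField 𝕜] {V : Type*} [AddCommGroup V] [Module 𝕜 V]
    {W : Type*} [AddCommGroup W] [Module 𝕜 W] [TopologicalSpace W] [ContinuousAdd W]
    {F G : V → W} {a b : W} {z v : V} (hF : HasDirDeriv 𝕜 F a z v) (hG : HasDirDeriv 𝕜 G b z v) :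
    HasDirDeriv 𝕜 (fun w => F w + G w) (a + b) z v := by
  refine (Tendsto.add hF hG).congr fun t => ?_
  rw [← smul_add, sub_add_sub_comm]

theorem HasDirDeriv.clm {F : (Fin d → ℂ) → E} {a : E} {z v : Fin d → ℂ}
    (hF : HasDirDeriv ℂ F a z v) (T : E →L[ℂ] E') :
    HasDirDeriv ℂ (fun w => T (F w)) (T a) z v := by
  refine ((T.continuous.tendsto a).comp hF).congr fun t => ?_
  simp

theorem HasDirDeriv.clm_real {F : (Fin d → ℂ) → E} {a : E} {z v : Fin d → ℂ}
    (hF : HasDirDeriv ℝ F a z v) (T : E →L[ℂ] E') :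
    HasDirDeriv ℝ (fun w => T (F w)) (T a) z v := by
  refine ((T.continuous.tendsto a).comp hF).congr fun t => ?_
  have h : ∀ (s : ℝ) (x : E), T (s • x) = s • T x := fun s x => by
    rw [← Complex.coe_smul s x, ← Complex.coe_smul s (T x), map_smul]
  simp [h]

theorem HasDirDeriv.partialC_eq [T2Space E] {F : (Fin d → ℂ) → E} {a : E} {z : Fin d → ℂ}
    {j : Fin d} (hF : HasDirDeriv ℂ F a z (Pi.single j 1)) : partialC j F z = a :=
  Tendsto.limUnder_eq hF

theorem hasDirDeriv_partialC {F : (Fin d → ℂ) → E} {z : Fin d → ℂ} {j : Fin d}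
    (hF : ∃ a, HasDirDeriv ℂ F a z (Pi.single j 1)) :
    HasDirDeriv ℂ F (partialC j F z) z (Pi.single j 1) :=
  tendsto_nhds_limUnder hF

theorem partialsExist_add [T2Space E] [ContinuousAdd E] {Ω : Set (Fin d → ℂ)} (hΩ : IsOpen Ω)
    {F G H : (Fin d → ℂ) → E} (hH : Set.EqOn H (fun w => F w + G w) Ω) :
    ∀ L : List (Fin d), PartialsExist Ω L F → PartialsExist Ω L G → PartialsExist Ω L H ∧
      Set.EqOn (iterPartial L H) (fun w => iterPartial L F w + iterPartial L G w) Ω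
  | [], _, _ => ⟨trivial, hH⟩
  | j :: L, hF, hG => by
    obtain ⟨h1, h2⟩ := partialsExist_add hΩ hH L hF.1 hG.1
    have key : ∀ z ∈ Ω, HasDirDeriv ℂ (iterPartial L H)
        (partialC j (iterPartial L F) z + partialC j (iterPartial L G) z) z (Pi.single j 1) :=
      fun z hz => ((hasDirDeriv_partialC (hF.2 z hz)).add
        (hasDirDeriv_partialC (hG.2 z hz))).congr_on hΩ hz h2
    exact ⟨⟨h1, fun z hz => ⟨_, key z hz⟩⟩, fun z hz => (key z hz).partialC_eq⟩

theorem partialsExist_clm [T2Space E'] {Ω : Set (Fin d → ℂ)} (hΩ : IsOpen Ω)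
    {F : (Fin d → ℂ) → E} {H : (Fin d → ℂ) → E'} (T : E →L[ℂ] E')
    (hH : Set.EqOn H (fun w => T (F w)) Ω) :
    ∀ L : List (Fin d), PartialsExist Ω L F → PartialsExist Ω L H ∧
      Set.EqOn (iterPartial L H) (fun w => T (iterPartial L F w)) Ω
  | [], _ => ⟨trivial, hH⟩
  | j :: L, hF => by
    obtain ⟨h1, h2⟩ := partialsExist_clm hΩ T hH L hF.1
    have key : ∀ z ∈ Ω, HasDirDeriv ℂ (iterPartial L H)
        (T (partialC j (iterPartial L F) z)) z (Pi.single j 1) :=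
      fun z hz => ((hasDirDeriv_partialC (hF.2 z hz)).clm T).congr_on hΩ hz h2
    exact ⟨⟨h1, fun z hz => ⟨_, key z hz⟩⟩, fun z hz => (key z hz).partialC_eq⟩

theorem hasDirDeriv_mvPolynomial (P : MvPolynomial (Fin d) ℂ) (z : Fin d → ℂ) (j : Fin d) (c : ℂ) :
    HasDerivAt (fun t : ℂ => MvPolynomial.eval (z + t • (Pi.single j c : Fin d → ℂ)) P)
      (c * MvPolynomial.eval z (MvPolynomial.pderiv j P)) 0 := by
  induction P using MvPolynomial.induction_on with
  | C a => simpa using hasDerivAt_const (0 : ℂ) a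
  | add p q hp hq => simpa [mul_add] using hp.fun_add hq
  | mul_X p i hp =>
    have hX : HasDerivAt (fun t : ℂ => z i + t * (Pi.single j c : Fin d → ℂ) i)
        ((Pi.single j c : Fin d → ℂ) i) 0 := by
      simpa using ((hasDerivAt_id (0 : ℂ)).mul_const _).const_add (z i)
    have := hp.mul hX
    simp only [map_mul, MvPolynomial.eval_X, Pi.add_apply, Pi.smul_apply, smul_eq_mul]
    refine this.congr_deriv ?_
    by_cases hij : i = j
    · subst hij; simp [MvPolynomial.pderiv_X]; ring
    · simp [MvPolynomial.pderiv_X, hij]; ring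

theorem partialsExist_mvPolynomial {Ω : Set (Fin d → ℂ)} (hΩ : IsOpen Ω)
    {F : (Fin d → ℂ) → ℂ} (P : MvPolynomial (Fin d) ℂ)
    (hF : Set.EqOn F (fun w => MvPolynomial.eval w P) Ω) :
    ∀ L : List (Fin d), PartialsExist Ω L F ∧ ∃ Q : MvPolynomial (Fin d) ℂ,
      Set.EqOn (iterPartial L F) (fun w => MvPolynomial.eval w Q) Ω
  | [] => ⟨trivial, P, hF⟩
  | j :: L => by
    obtain ⟨h1, Q, h2⟩ := partialsExist_mvPolynomial hΩ P hF L
    have key : ∀ z ∈ Ω, HasDirDeriv ℂ (iterPartial L F)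
        (MvPolynomial.eval z (MvPolynomial.pderiv j Q)) z (Pi.single j 1) := fun z hz => by
      refine HasDirDeriv.congr_on hΩ hz ?_ h2
      have := (hasDirDeriv_mvPolynomial Q z j 1).tendsto_slope_zero
      simpa [HasDirDeriv] using this
    exact ⟨⟨h1, fun z hz => ⟨_, key z hz⟩⟩, _, fun z hz => (key z hz).partialC_eq⟩

theorem hasContRealPartials_mvPolynomial {Ω : Set (Fin d → ℂ)} (hΩ : IsOpen Ω)
    {F : (Fin d → ℂ) → ℂ} (P : MvPolynomial (Fin d) ℂ)
    (hF : Set.EqOn F (fun w => MvPolynomial.eval w P) Ω) : HasContRealPartials Ω F := by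
  intro j c _
  refine ⟨fun w => c * MvPolynomial.eval w (MvPolynomial.pderiv j P),
    (continuous_const.mul (MvPolynomial.continuous_eval _)).continuousOn, fun z hz => ?_⟩
  refine HasDirDeriv.congr_on hΩ hz ?_ hF
  have h := (hasDirDeriv_mvPolynomial P z j c).tendsto_slope_zero
  have hr : Tendsto (fun t : ℝ => (t : ℂ)) (𝓝[≠] 0) (𝓝[≠] 0) := by
    refine tendsto_nhdsWithin_iff.2 ⟨?_, ?_⟩
    · exact (Complex.continuous_ofReal.tendsto' 0 0 (by simp)).mono_left nhdsWithin_le_nhds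
    · filter_upwards [self_mem_nhdsWithin] with t ht
      simpa using ht
  refine (h.comp hr).congr fun t => ?_
  simp

theorem zeroExt_add {Ω : Opens (Fin d → ℂ)} (f g : Ω → E) :
    Set.EqOn (zeroExt (fun w => f w + g w)) (fun w => zeroExt f w + zeroExt g w) Ω :=
  fun w (hw : w ∈ Ω) => by simp [zeroExt_of_mem _ hw]

theorem zeroExt_clm {Ω : Opens (Fin d → ℂ)} (f : Ω → E) (T : E →L[ℂ] E') :
    Set.EqOn (zeroExt (fun w => T (f w))) (fun w => T (zeroExt f w)) Ω :=
  fun w (hw : w ∈ Ω) => by simp [zeroExt_of_mem _ hw]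

end Lemmas

/-! ### The space `𝒪(Ω, E)` -/

section HolSpace

variable {d : ℕ}

/-- Membership in `𝒪(Ω, E)` for a continuous function `f : Ω → E`: `f` is continuously partially
real differentiable and for every multi-index `β` the complex partial derivative `∂^β f` exists in
`E` at every point of `Ω`. -/
def IsHol {Ω : Opens (Fin d → ℂ)} {E : Type*} [AddCommGroup E] [Module ℂ E] [TopologicalSpace E]
    (f : C(Ω, E)) : Prop :=
  HasContRealPartials (Ω : Set (Fin d → ℂ)) (zeroExt f) ∧
    ∀ β : Fin d → ℕ, PartialsExist (Ω : Set (Fin d → ℂ)) (multiIndexList β) (zeroExt f)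

variable {Ω : Opens (Fin d → ℂ)}
variable {E : Type*} [AddCommGroup E] [Module ℂ E] [TopologicalSpace E]
  [IsTopologicalAddGroup E] [ContinuousSMul ℂ E] [T2Space E]
variable {E' : Type*} [AddCommGroup E'] [Module ℂ E'] [TopologicalSpace E']
  [IsTopologicalAddGroup E'] [ContinuousSMul ℂ E'] [T2Space E']

theorem IsHol.add {f g : C(Ω, E)} (hf : IsHol f) (hg : IsHol g) : IsHol (f + g) := by
  have h : Set.EqOn (zeroExt (f + g : C(Ω, E))) (fun w => zeroExt f w + zeroExt g w) Ω :=
    zeroExt_add f g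
  refine ⟨fun j c hc => ?_, fun β => (partialsExist_add Ω.isOpen h _ (hf.2 β) (hg.2 β)).1⟩
  obtain ⟨A, hA, hA'⟩ := hf.1 j c hc
  obtain ⟨B, hB, hB'⟩ := hg.1 j c hc
  exact ⟨fun w => A w + B w, hA.add hB, fun z hz =>
    ((hA' z hz).add (hB' z hz)).congr_on Ω.isOpen hz h⟩

theorem IsHol.clm {f : C(Ω, E)} (hf : IsHol f) (T : E →L[ℂ] E') {g : C(Ω, E')}
    (hg : ∀ w, g w = T (f w)) : IsHol g := by
  have h : Set.EqOn (zeroExt g) (fun w => T (zeroExt f w)) Ω := by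
    have : (g : Ω → E') = fun w => T (f w) := funext hg
    rw [this]
    exact zeroExt_clm f T
  refine ⟨fun j c hc => ?_, fun β => (partialsExist_clm Ω.isOpen T h _ (hf.2 β)).1⟩
  obtain ⟨A, hA, hA'⟩ := hf.1 j c hc
  exact ⟨fun w => T (A w), T.continuous.comp_continuousOn hA, fun z hz =>
    ((hA' z hz).clm_real T).congr_on Ω.isOpen hz h⟩

theorem isHol_mvPolynomial (P : MvPolynomial (Fin d) ℂ) {g : C(Ω, ℂ)}
    (hg : ∀ w : Ω, g w = MvPolynomial.eval (w : Fin d → ℂ) P) : IsHol g := by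
  have h : Set.EqOn (zeroExt g) (fun w => MvPolynomial.eval w P) Ω :=
    fun w (hw : w ∈ Ω) => by simp [zeroExt_of_mem _ hw, hg]
  exact ⟨hasContRealPartials_mvPolynomial Ω.isOpen P h,
    fun β => (partialsExist_mvPolynomial Ω.isOpen P h _).1⟩

/-- The space `𝒪(Ω, E)`. It carries the topology induced from the compact-open topology of
`C(Ω, E)`, i.e. the one of the seminorms `sup_{z ∈ K} p(f z)`, `K ⊆ Ω` compact, `p` a continuous
seminorm of `E`. -/
def HolSpace (Ω : Opens (Fin d → ℂ)) (E : Type*) [AddCommGroup E] [Module ℂ E]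
    [TopologicalSpace E] [IsTopologicalAddGroup E] [ContinuousSMul ℂ E] [T2Space E] :
    Submodule ℂ C(Ω, E) where
  carrier := {f | IsHol f}
  add_mem' := IsHol.add
  zero_mem' := (isHol_mvPolynomial (Ω := Ω) (g := 0) 0 (by simp)).clm (0 : ℂ →L[ℂ] E) (by simp)
  smul_mem' c _ hf := IsHol.clm hf (c • ContinuousLinearMap.id ℂ E) (by simp)

/-- The function `z ↦ g(z) e` in `𝒪(Ω, E)` for `g ∈ 𝒪(Ω)` and `e ∈ E`. -/
def elemTensor (g : HolSpace Ω ℂ) (e : E) : HolSpace Ω E :=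
  ⟨⟨fun w => g.1 w • e, by fun_prop⟩,
    IsHol.clm g.2 (ContinuousLinearMap.toSpanSingleton ℂ e) (by simp)⟩

@[simp] theorem elemTensor_apply (g : HolSpace Ω ℂ) (e : E) (w : Ω) :
    (elemTensor g e).1 w = g.1 w • e := rfl

/-- The canonical map `𝒪(Ω) ⊗ E → 𝒪(Ω, E)`, `g ⊗ e ↦ [z ↦ g(z) e]`. -/
def tensorMap (Ω : Opens (Fin d → ℂ)) (E : Type*) [AddCommGroup E] [Module ℂ E]
    [TopologicalSpace E] [IsTopologicalAddGroup E] [ContinuousSMul ℂ E] [T2Space E] :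
    (HolSpace Ω ℂ ⊗[ℂ] E) →ₗ[ℂ] HolSpace Ω E :=
  TensorProduct.lift <| LinearMap.mk₂ ℂ elemTensor
    (fun _ _ _ => Subtype.ext <| ContinuousMap.ext fun _ => add_smul _ _ _)
    (fun _ _ _ => Subtype.ext <| ContinuousMap.ext fun _ => mul_smul _ _ _)
    (fun _ _ _ => Subtype.ext <| ContinuousMap.ext fun _ => smul_add _ _ _)
    (fun _ _ _ => Subtype.ext <| ContinuousMap.ext fun _ => smul_comm _ _ _)

/-- The monomial `(· - z)^β` as an element of `𝒪(Ω)`. -/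
def holMonomial (Ω : Opens (Fin d → ℂ)) (z : Fin d → ℂ) (β : Fin d → ℕ) : HolSpace Ω ℂ :=
  ⟨⟨fun w => ∏ j, ((w : Fin d → ℂ) j - z j) ^ β j,
    continuous_finsetProd _ fun j _ =>
      (((continuous_apply j).comp continuous_subtype_val).sub continuous_const).pow _⟩,
    isHol_mvPolynomial (∏ j, (MvPolynomial.X j - MvPolynomial.C (z j)) ^ β j)
      (by simp)⟩

/-- The polydisc `𝔻_R(z) = ∏ₖ {w ∈ ℂ : |w - zₖ| < Rₖ}`, where the radii may be `∞`. -/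
def polydisc (z : Fin d → ℂ) (R : Fin d → ℝ≥0∞) : Opens (Fin d → ℂ) where
  carrier := {w | ∀ k, edist (w k) (z k) < R k}
  is_open' := by
    simp only [Set.ofPred_forall]
    exact isOpen_iInter_of_finite fun k => isOpen_lt (by fun_prop) continuous_const

/-- The Taylor coefficient `∂^β f(z) / β!`. -/
def taylorCoeff (f : HolSpace Ω E) (z : Fin d → ℂ) (β : Fin d → ℕ) : E :=
  ((∏ j, (β j).factorial : ℕ) : ℂ)⁻¹ • partialMulti β (zeroExt f.1) z

end HolSpace

end

/-!
Since all complex partial derivatives of `f` are assumed to exist in `E`, the Taylor coefficients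
are elements of `E`, and only the convergence of the series has to be shown. By Hahn–Banach in the
form `exists_nhds_zero_bipolar_subset`, this is a statement about the scalar functions `φ ∘ f`,
uniform over the continuous functionals `φ` bounded by `1` on a given neighbourhood `V` of `0`.

Given a compact `K` in the polydisc, pick radii `ρ < r` such that `K` lies in the closed polydisc
of radii `ρ` and the closed polydisc of radii `r` still lies in the domain. Its image under `f` is
compact, hence contained in `M • V` for some `M > 0`, so `|φ ∘ f| ≤ M` there for all such `φ`.
The Cauchy estimates `|φ (∂^β f(z) / β!)| r^β ≤ M` bound the `β`-th term of the expansion of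
`φ ∘ f` on `K` by `M (ρ / r)^β`, which is summable and does not depend on `φ`
(`eventually_remainder_mem`).

For scalar functions, the Cauchy estimates and the Taylor expansion are obtained together by
induction on the number of variables, from the theory in one variable
(`cauchy_estimate_and_hasSum_taylor`). Sequential density of `𝒪(𝔻_R(z)) ⊗ E` follows because the
partial sums of the Taylor series come from tensors and there are only countably many
multi-indices.
-/

/-! ### Multi-index bookkeeping -/

theorem summable_prod_pow {d : ℕ} {q : Fin d → ℝ} (h0 : ∀ k, 0 ≤ q k) (h1 : ∀ k, q k < 1) :
    Summable fun β : Fin d → ℕ => ∏ k, q k ^ β k := by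
  refine summable_of_sum_le (c := ∏ k, (1 - q k)⁻¹)
    (fun β => Finset.prod_nonneg fun k _ => pow_nonneg (h0 k) _) fun S => ?_
  -- A finite set of multi-indices lies in a box, over which the sum of products factorizes.
  let t : Fin d → Finset ℕ := fun k => S.image fun β => β k
  calc ∑ β ∈ S, ∏ k, q k ^ β k ≤ ∑ β ∈ Fintype.piFinset t, ∏ k, q k ^ β k := by
        refine Finset.sum_le_sum_of_subset_of_nonneg (fun β hβ => ?_)
          fun β _ _ => Finset.prod_nonneg fun k _ => pow_nonneg (h0 k) _
        exact Fintype.mem_piFinset.2 fun k => Finset.mem_image_of_mem _ hβ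
    _ = ∏ k, ∑ n ∈ t k, q k ^ n := (Finset.prod_univ_sum t fun k n => q k ^ n).symm
    _ ≤ ∏ k, (1 - q k)⁻¹ := by
        refine Finset.prod_le_prod (fun k _ => Finset.sum_nonneg fun n _ => pow_nonneg (h0 k) _)
          fun k _ => ?_
        rw [← tsum_geometric_of_lt_one (h0 k) (h1 k)]
        exact (summable_geometric_of_lt_one (h0 k) (h1 k)).sum_le_tsum _
          fun n _ => pow_nonneg (h0 k) _

theorem multiIndexList_cons {d : ℕ} (n : ℕ) (β : Fin d → ℕ) :
    multiIndexList (Fin.cons n β : Fin (d + 1) → ℕ) =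
      List.replicate n 0 ++ (multiIndexList β).map Fin.succ := by
  simp [multiIndexList, List.finRange_succ, List.flatMap_map, List.map_flatMap]

section Slices

variable {d : ℕ} {E : Type*} [AddCommGroup E] [Module ℂ E] [TopologicalSpace E]

theorem iterPartial_append (L₁ L₂ : List (Fin d)) (F : (Fin d → ℂ) → E) :
    iterPartial (L₁ ++ L₂) F = iterPartial L₁ (iterPartial L₂ F) := by
  induction L₁ with
  | nil => rfl
  | cons j L ih => simp [iterPartial, ih]

theorem partialsExist_append {Ω : Set (Fin d → ℂ)} {L₁ L₂ : List (Fin d)}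
    {F : (Fin d → ℂ) → E} :
    PartialsExist Ω (L₁ ++ L₂) F ↔
      PartialsExist Ω L₂ F ∧ PartialsExist Ω L₁ (iterPartial L₂ F) := by
  induction L₁ with
  | nil => simp [PartialsExist]
  | cons j L ih => simp [PartialsExist, ih, iterPartial_append, and_assoc]

theorem cons_add_smul_single_zero (b t : ℂ) (w : Fin d → ℂ) :
    (Fin.cons b w : Fin (d + 1) → ℂ) + t • (Pi.single 0 1 : Fin (d + 1) → ℂ) =
      Fin.cons (b + t) w := by
  ext k
  refine Fin.cases ?_ (fun i => ?_) k <;> simp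

theorem cons_add_smul_single_succ (b t : ℂ) (w : Fin d → ℂ) (j : Fin d) :
    (Fin.cons b w : Fin (d + 1) → ℂ) + t • (Pi.single j.succ 1 : Fin (d + 1) → ℂ) =
      Fin.cons b (w + t • (Pi.single j 1 : Fin d → ℂ)) := by
  ext k
  refine Fin.cases ?_ (fun i => ?_) k
  · simp
  · by_cases h : i = j
    · subst h; simp
    · simp [h]

theorem hasDirDeriv_single_succ {F : (Fin (d + 1) → ℂ) → E} {e : E} {b : ℂ} {w : Fin d → ℂ}
    {j : Fin d} :
    HasDirDeriv ℂ F e (Fin.cons b w) (Pi.single j.succ 1) ↔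
      HasDirDeriv ℂ (fun v => F (Fin.cons b v)) e w (Pi.single j 1) := by
  simp only [HasDirDeriv, cons_add_smul_single_succ]

theorem hasDirDeriv_single_zero {F : (Fin (d + 1) → ℂ) → ℂ} {e b : ℂ} {w : Fin d → ℂ} :
    HasDirDeriv ℂ F e (Fin.cons b w) (Pi.single 0 1) ↔
      HasDerivAt (fun a => F (Fin.cons a w)) e b := by
  simp only [HasDirDeriv, cons_add_smul_single_zero, hasDerivAt_iff_tendsto_slope_zero]

theorem iterPartial_map_succ (L : List (Fin d)) (F : (Fin (d + 1) → ℂ) → E) (b : ℂ) :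
    (fun w => iterPartial (L.map Fin.succ) F (Fin.cons b w)) =
      iterPartial L fun w => F (Fin.cons b w) := by
  induction L with
  | nil => rfl
  | cons j L ih =>
    funext w
    rw [List.map_cons, iterPartial, iterPartial, ← ih]
    simp only [partialC, cons_add_smul_single_succ]

theorem PartialsExist.slice {U : Fin (d + 1) → Set ℂ} {L : List (Fin d)}
    {F : (Fin (d + 1) → ℂ) → E} (h : PartialsExist (Set.univ.pi U) (L.map Fin.succ) F)
    {b : ℂ} (hb : b ∈ U 0) :
    PartialsExist (Set.univ.pi fun k : Fin d => U k.succ) L fun w => F (Fin.cons b w) := by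
  induction L with
  | nil => trivial
  | cons j L ih =>
    refine ⟨ih h.1, fun w hw => ?_⟩
    obtain ⟨e, he⟩ := h.2 (Fin.cons b w)
      fun k _ => Fin.cases (by simpa using hb) (fun i => by simpa using hw i trivial) k
    rw [hasDirDeriv_single_succ, iterPartial_map_succ] at he
    exact ⟨e, he⟩

/-- Along a line parallel to the first axis, repeated partial differentiation in the first
variable is the iterated one-variable derivative. -/
theorem iterPartial_replicate_zero {V : Set ℂ} (hV : IsOpen V) {H : (Fin (d + 1) → ℂ) → ℂ}
    {w : Fin d → ℂ} (h : ∀ n, ∀ b ∈ V, ∃ e,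
      HasDirDeriv ℂ (iterPartial (List.replicate n 0) H) e (Fin.cons b w) (Pi.single 0 1))
    (n : ℕ) : ∀ b ∈ V, iterPartial (List.replicate n 0) H (Fin.cons b w) =
      iteratedDeriv n (fun a => H (Fin.cons a w)) b := by
  induction n with
  | zero => intro b _; simp [iterPartial]
  | succ n ih =>
    intro b hb
    obtain ⟨e, he⟩ := h n b hb
    rw [List.replicate_succ, iterPartial, he.partialC_eq, iteratedDeriv_succ,
      ← (hasDirDeriv_single_zero.1 he).deriv]
    exact Filter.EventuallyEq.deriv_eq (eventually_of_mem (hV.mem_nhds hb) ih)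

end Slices

/-! ### Taylor expansion of scalar functions on polydiscs -/

/-- Cauchy estimates and Taylor expansion for a bounded scalar function all of whose complex
partial derivatives exist. The proof is by induction on the number of variables: the Taylor
coefficients of the slices `F (b, ·)` are functions of `b` that are holomorphic and, by the
estimates for the slices, bounded, so that the one-variable theory applies to them. -/
theorem cauchy_estimate_and_hasSum_taylor {d : ℕ} : ∀ {U : Fin d → Set ℂ} (_ : ∀ k, IsOpen (U k))
    {z : Fin d → ℂ} {r : Fin d → ℝ} (_ : ∀ k, 0 < r k)
    (_ : ∀ k, Metric.closedBall (z k) (r k) ⊆ U k) {F : (Fin d → ℂ) → ℂ} {M : ℝ}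
    (_ : ∀ w, (∀ k, w k ∈ Metric.closedBall (z k) (r k)) → ‖F w‖ ≤ M)
    (_ : ∀ β, PartialsExist (Set.univ.pi U) (multiIndexList β) F),
    (∀ β : Fin d → ℕ, ‖((∏ k, (β k).factorial : ℕ) : ℂ)⁻¹ * partialMulti β F z‖ *
      ∏ k, r k ^ β k ≤ M) ∧
    ∀ w, (∀ k, w k ∈ Metric.ball (z k) (r k)) →
      HasSum (fun β : Fin d → ℕ => ((∏ k, (β k).factorial : ℕ) : ℂ)⁻¹ * partialMulti β F z *
        ∏ k, (w k - z k) ^ β k) (F w) := by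
  induction d with
  | zero =>
    intro U _ z r _ _ F M hM _
    refine ⟨fun β => ?_, fun w _ => ?_⟩
    · simpa [partialMulti, multiIndexList, iterPartial] using hM z (fun k => k.elim0)
    · have : w = z := Subsingleton.elim _ _
      subst this
      simp [partialMulti, multiIndexList, iterPartial]
  | succ d ih =>
    intro U hU z r hr hrU F M hM hex
    obtain ⟨b₀, z', rfl⟩ : ∃ b₀ z', z = Fin.cons b₀ z' := ⟨z 0, Fin.tail z, by simp⟩
    have hz' : ∀ k : Fin d, z' k ∈ U k.succ := fun k =>
      hrU k.succ (by simpa using (hr k.succ).le)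
    simp only [Fin.forall_fin_succ, Fin.cons_zero, Fin.cons_succ] at hrU hM hU hr
    have hslice := fun {b : ℂ} (hb : b ∈ Metric.closedBall b₀ (r 0)) =>
      ih hU.2 hr.2 hrU.2 (F := fun w => F (Fin.cons b w)) (M := M)
        (fun w hw => hM _ (by simpa using ⟨hb, hw⟩))
        (fun β => (by simpa [multiIndexList_cons] using hex (Fin.cons 0 β) :
          PartialsExist (Set.univ.pi U) ((multiIndexList β).map Fin.succ) F).slice (hrU.1 hb))
    -- The Taylor coefficients of the slices, up to the factor `1 / β!`.
    let G : (Fin d → ℕ) → ℂ → ℂ := fun β b => partialMulti β (fun w => F (Fin.cons b w)) z'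
    have hGeq : ∀ β b, iterPartial ((multiIndexList β).map Fin.succ) F (Fin.cons b z') = G β b :=
      fun β b => congrFun (iterPartial_map_succ _ F b) z'
    have hline : ∀ (β : Fin d → ℕ) (n : ℕ), ∀ b ∈ U 0, ∃ e, HasDirDeriv ℂ (iterPartial
        (List.replicate n 0) (iterPartial ((multiIndexList β).map Fin.succ) F)) e
        (Fin.cons b z') (Pi.single 0 1) := by
      intro β n b hb
      have h := hex (Fin.cons (n + 1) β)
      rw [multiIndexList_cons, partialsExist_append] at h
      exact h.2.2 _ fun k _ => Fin.cases (by simpa using hb) (fun i => by simpa using hz' i) k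
    have hGdiff : ∀ β, DifferentiableOn ℂ (G β) (U 0) := by
      intro β b hb
      obtain ⟨e, he⟩ := hline β 0 b hb
      have he' := hasDirDeriv_single_zero.1 he
      simp only [List.replicate_zero, iterPartial, hGeq] at he'
      exact he'.differentiableAt.differentiableWithinAt
    have hpart : ∀ n β, partialMulti (Fin.cons n β) F (Fin.cons b₀ z') =
        iteratedDeriv n (G β) b₀ := by
      intro n β
      rw [partialMulti, multiIndexList_cons, iterPartial_append,
        iterPartial_replicate_zero hU.1 (hline β) n b₀ (hrU.1 (by simpa using hr.1.le))]
      simp only [hGeq]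
    have hest : ∀ β : Fin (d + 1) → ℕ, ‖((∏ k, (β k).factorial : ℕ) : ℂ)⁻¹ *
        partialMulti β F (Fin.cons b₀ z')‖ * ∏ k, r k ^ β k ≤ M := by
      intro β
      obtain ⟨n, β', rfl⟩ : ∃ n β', β = Fin.cons n β' := ⟨β 0, Fin.tail β, by simp⟩
      have hpos : 0 < ∏ k : Fin d, r k.succ ^ β' k :=
        Finset.prod_pos fun k _ => pow_pos (hr.2 k) _
      have hf : (0 : ℝ) < ((∏ k, (β' k).factorial : ℕ) : ℝ) := by
        exact_mod_cast Finset.prod_pos fun k _ => Nat.factorial_pos _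
      have hG : ∀ b ∈ Metric.closedBall b₀ (r 0),
          ‖G β' b‖ ≤ M / (∏ k : Fin d, r k.succ ^ β' k) * ((∏ k, (β' k).factorial : ℕ) : ℝ) := by
        intro b hb
        have h := (hslice hb).1 β'
        rw [norm_mul, norm_inv, Complex.norm_natCast, ← le_div_iff₀ hpos, inv_mul_eq_div,
          div_le_iff₀ hf] at h
        exact h
      have hc := Complex.norm_iteratedDeriv_le_of_forall_mem_sphere_norm_le n hr.1
        (f := G β') (c := b₀)
        (((hGdiff β').mono (Metric.closure_ball_subset_closedBall.trans hrU.1)).diffContOnCl)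
        fun b hb => hG b (Metric.sphere_subset_closedBall hb)
      have hn : (0 : ℝ) < (n.factorial : ℝ) := by exact_mod_cast n.factorial_pos
      have hrn : 0 < r 0 ^ n := pow_pos hr.1 n
      rw [hpart]
      simp only [Fin.prod_univ_succ, Fin.cons_zero, Fin.cons_succ, norm_mul, norm_inv,
        Nat.cast_mul, Complex.norm_natCast]
      calc _ ≤ ((n.factorial : ℝ) * ((∏ k, (β' k).factorial : ℕ) : ℝ))⁻¹ *
            (n.factorial * (M / (∏ k : Fin d, r k.succ ^ β' k) *
              ((∏ k, (β' k).factorial : ℕ) : ℝ)) / r 0 ^ n) *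
            (r 0 ^ n * ∏ k : Fin d, r k.succ ^ β' k) := by gcongr
        _ = M := by field_simp
    refine ⟨hest, fun w hw => ?_⟩
    have hsummable : Summable fun β : Fin (d + 1) → ℕ => ((∏ k, (β k).factorial : ℕ) : ℂ)⁻¹ *
        partialMulti β F (Fin.cons b₀ z') *
          ∏ k, (w k - (Fin.cons b₀ z' : Fin (d + 1) → ℂ) k) ^ β k := by
      have hr' : ∀ k, 0 < r k := Fin.forall_fin_succ.2 hr
      refine Summable.of_norm_bounded ((summable_prod_pow
        (q := fun k => ‖w k - (Fin.cons b₀ z' : Fin (d + 1) → ℂ) k‖ / r k)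
        (fun k => by have := hr' k; positivity)
        fun k => (div_lt_one (hr' k)).2 (by simpa [dist_eq_norm] using hw k)).mul_left M)
        fun β => ?_
      have hpos : 0 < ∏ k, r k ^ β k := Finset.prod_pos fun k _ => pow_pos (hr' k) _
      rw [norm_mul, norm_prod]
      simp only [norm_pow, div_pow, Finset.prod_div_distrib]
      rw [← mul_div_assoc, le_div_iff₀ hpos]
      calc _ = (‖((∏ k, (β k).factorial : ℕ) : ℂ)⁻¹ * partialMulti β F (Fin.cons b₀ z')‖ *
            ∏ k, r k ^ β k) *
            ∏ k, ‖w k - (Fin.cons b₀ z' : Fin (d + 1) → ℂ) k‖ ^ β k := by ring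
        _ ≤ _ := by gcongr; exact hest β
    obtain ⟨b, w', rfl⟩ : ∃ b w', w = Fin.cons b w' := ⟨w 0, Fin.tail w, by simp⟩
    simp only [Fin.forall_fin_succ, Fin.cons_zero, Fin.cons_succ] at hw
    -- Sum over the first index for a fixed tail, then over the tails.
    let e : (Fin d → ℕ) × ℕ ≃ (Fin (d + 1) → ℕ) :=
      (Equiv.prodComm _ _).trans (Fin.consEquiv fun _ => ℕ)
    have hinner : ∀ β' : Fin d → ℕ, HasSum (fun n => ((∏ k, ((Fin.cons n β' : Fin (d + 1) → ℕ)
        k).factorial : ℕ) : ℂ)⁻¹ * partialMulti (Fin.cons n β') F (Fin.cons b₀ z') *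
        ∏ k, ((Fin.cons b w' : Fin (d + 1) → ℂ) k - (Fin.cons b₀ z' : Fin (d + 1) → ℂ) k) ^
          (Fin.cons n β' : Fin (d + 1) → ℕ) k)
        (((∏ k, (β' k).factorial : ℕ) : ℂ)⁻¹ * G β' b * ∏ k, (w' k - z' k) ^ β' k) := by
      intro β'
      have h := Complex.hasSum_taylorSeries_on_ball
        ((hGdiff β').mono (Metric.ball_subset_closedBall.trans hrU.1)) hw.1
      have h' := (h.mul_left ((∏ k, (β' k).factorial : ℕ) : ℂ)⁻¹).mul_right
        (∏ k, (w' k - z' k) ^ β' k)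
      refine (congrArg (HasSum · _) (funext fun n => ?_)).mpr h'
      rw [hpart]
      simp only [Fin.prod_univ_succ, Fin.cons_zero, Fin.cons_succ, Nat.cast_mul, mul_inv,
        smul_eq_mul]
      ring
    have hfib := ((e.summable_iff.2 hsummable).hasSum).prod_fiberwise hinner
    have := hfib.unique ((hslice (Metric.ball_subset_closedBall hw.1)).2 w' hw.2)
    rw [← e.hasSum_iff, ← this]
    exact (e.summable_iff.2 hsummable).hasSum

/-! ### Detecting neighbourhoods of zero by functionals -/

open scoped ComplexOrder in
/-- A form of the bipolar theorem: in a locally convex space, every neighbourhood of `0` contains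
the bipolar of some neighbourhood of `0`. -/
theorem exists_nhds_zero_bipolar_subset {E : Type*} [AddCommGroup E] [Module ℂ E]
    [TopologicalSpace E] [IsTopologicalAddGroup E] [ContinuousSMul ℂ E] [LocallyConvexSpace ℝ E]
    {U : Set E} (hU : U ∈ 𝓝 (0 : E)) :
    ∃ V ∈ 𝓝 (0 : E), ∀ x : E,
      (∀ φ : E →L[ℂ] ℂ, (∀ v ∈ V, ‖φ v‖ ≤ 1) → ‖φ x‖ ≤ 1) → x ∈ U := by
  have hlc : LocallyConvexSpace ℂ E := ⟨fun x =>
    (LocallyConvexSpace.convex_basis (𝕜 := ℝ) x).congr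
      (fun _ => and_congr_right fun _ => convex_RCLike_iff_convex_real.symm) fun _ _ => rfl⟩
  obtain ⟨V, ⟨hV, hVc, hVb, hVconv⟩, hVU⟩ := (nhds_hasBasis_absConvex_closed ℂ E).mem_iff.1 hU
  refine ⟨V, hV, fun x hx => hVU (by_contra fun hxV => ?_)⟩
  obtain ⟨φ, u, hφ, hux⟩ := RCLike.geometric_hahn_banach_closed_point (𝕜 := ℂ)
    (convex_RCLike_iff_convex_real.1 hVconv) hVc hxV
  have hu : 0 < u := by simpa using hφ 0 (mem_of_mem_nhds hV)
  have hle : ∀ v ∈ V, ‖φ v‖ ≤ u := by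
    intro v hv
    -- Rotate `v` inside the balanced set `V` so that `φ` takes a nonnegative real value.
    obtain ⟨c, hc, hcv⟩ := RCLike.exists_norm_eq_mul_self (φ v)
    have h := (hφ (c • v) (hVb.smul_mem hc.le hv)).le
    rw [map_smul, smul_eq_mul, ← hcv] at h
    simpa using h
  have h := hx ((u : ℂ)⁻¹ • φ) fun v hv => by
    simpa [abs_of_pos hu, inv_mul_le_iff₀ hu] using hle v hv
  have hux' : u < ‖φ x‖ := hux.trans_le (Complex.re_le_norm _)
  simp only [smul_apply, smul_eq_mul, norm_mul, norm_inv, Complex.norm_real,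
    Real.norm_eq_abs, abs_of_pos hu, inv_mul_le_iff₀ hu, mul_one] at h
  exact h.not_gt hux'

theorem HasSum.norm_sub_sum_le_of_bounded {ι : Type*} {a : ι → ℂ} {g : ι → ℝ} {A : ℂ} {G : ℝ}
    (ha : HasSum a A) (hg : HasSum g G) (h : ∀ i, ‖a i‖ ≤ g i) (S : Finset ι) :
    ‖A - ∑ i ∈ S, a i‖ ≤ G - ∑ i ∈ S, g i := by
  refine HasSum.norm_le_of_bounded (f := fun i : {i // i ∉ S} => a i)
    (g := fun i : {i // i ∉ S} => g i) ?_ ?_ fun i => h i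
  · exact (S.hasSum_compl_iff).2 (by simpa using ha)
  · exact (S.hasSum_compl_iff).2 (by simpa using hg)

/-! ### Taylor expansion in `𝒪(𝔻_R(z), E)` -/

theorem continuousOn_zeroExt {E : Type*} [AddCommGroup E] [Module ℂ E] [TopologicalSpace E] {d : ℕ}
    {Ω : Opens (Fin d → ℂ)} (f : C(Ω, E)) : ContinuousOn (zeroExt f) Ω := by
  rw [continuousOn_iff_continuous_domRestrict]
  refine f.continuous.congr fun w => ?_
  exact (zeroExt_of_mem f w.2).symm

section Taylor

variable {E : Type*} [AddCommGroup E] [Module ℂ E] [TopologicalSpace E]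
    [IsTopologicalAddGroup E] [ContinuousSMul ℂ E] [T2Space E] {d : ℕ}

theorem coe_polydisc (z : Fin d → ℂ) (R : Fin d → ℝ≥0∞) :
    (polydisc z R : Set (Fin d → ℂ)) = Set.univ.pi fun k => Metric.eball (z k) (R k) := by
  ext w
  simp [polydisc, Metric.mem_eball]

theorem map_taylorCoeff {Ω : Opens (Fin d → ℂ)} (f : HolSpace Ω E) {z : Fin d → ℂ} (hz : z ∈ Ω)
    (φ : E →L[ℂ] ℂ) (β : Fin d → ℕ) :
    φ (taylorCoeff f z β) = ((∏ k, (β k).factorial : ℕ) : ℂ)⁻¹ *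
      partialMulti β (fun w => φ (zeroExt f.1 w)) z := by
  have h := (partialsExist_clm Ω.isOpen φ (fun w _ => rfl) _ (f.2.2 β)).2 hz
  rw [taylorCoeff, map_smul, smul_eq_mul, partialMulti, partialMulti, h]

/-- A compact subset of a polydisc lies in a smaller closed polydisc, and there is a further
polydisc of finite radii strictly in between. -/
theorem exists_radii_of_isCompact {z : Fin d → ℂ} {R : Fin d → ℝ≥0∞} (hR : ∀ k, 0 < R k)
    {K : Set (polydisc z R)} (hK : IsCompact K) :
    ∃ ρ r : Fin d → ℝ, (∀ k, 0 ≤ ρ k ∧ ρ k < r k ∧ Metric.closedBall (z k) (r k) ⊆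
      Metric.eball (z k) (R k)) ∧ ∀ w ∈ K, ∀ k, dist ((w : Fin d → ℂ) k) (z k) ≤ ρ k := by
  have key : ∀ k, ∃ ρ r : ℝ, (0 ≤ ρ ∧ ρ < r ∧ Metric.closedBall (z k) r ⊆
      Metric.eball (z k) (R k)) ∧ ∀ w ∈ K, dist ((w : Fin d → ℂ) k) (z k) ≤ ρ := by
    intro k
    obtain ⟨ρ, hρ, hρR, hKρ⟩ : ∃ ρ : ℝ, 0 ≤ ρ ∧ ENNReal.ofReal ρ < R k ∧
        ∀ w ∈ K, dist ((w : Fin d → ℂ) k) (z k) ≤ ρ := by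
      rcases K.eq_empty_or_nonempty with rfl | hne
      · exact ⟨0, le_rfl, by simpa using hR k, by simp⟩
      · obtain ⟨w₀, -, hmax⟩ := hK.exists_isMaxOn hne
          (f := fun w : polydisc z R => dist ((w : Fin d → ℂ) k) (z k))
          (((continuous_apply k).comp continuous_subtype_val).dist continuous_const).continuousOn
        exact ⟨_, dist_nonneg, by simpa [edist_dist] using w₀.2 k, fun w hw => hmax hw⟩
    obtain ⟨r, hρr, hrR⟩ := ENNReal.lt_iff_exists_nnreal_btwn.1 hρR
    refine ⟨ρ, r, ⟨hρ, ?_, fun w hw => ?_⟩, hKρ⟩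
    · have := (ENNReal.ofReal_lt_iff_lt_toReal hρ ENNReal.coe_ne_top).1 hρr
      simpa using this
    · rw [Metric.mem_eball, edist_nndist]
      refine lt_of_le_of_lt ?_ hrR
      exact_mod_cast (Metric.mem_closedBall.1 hw)
  choose ρ r h using key
  exact ⟨ρ, r, fun k => (h k).1, fun w hw k => (h k).2 w hw⟩

/-- The remainder estimate. Functionals in the polar of a neighbourhood `V` of `0` are uniformly
bounded on the compact image under `f` of a closed polydisc, so the scalar expansions of the
`φ ∘ f` converge uniformly in `φ` and on compact sets. -/
theorem eventually_remainder_mem [LocallyConvexSpace ℝ E] {z : Fin d → ℂ} {R : Fin d → ℝ≥0∞}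
    (hR : ∀ k, 0 < R k) (f : HolSpace (polydisc z R) E) {K : Set (polydisc z R)}
    (hK : IsCompact K) {U : Set E} (hU : U ∈ 𝓝 (0 : E)) :
    ∀ᶠ S : Finset (Fin d → ℕ) in atTop, ∀ w ∈ K,
      f.1 w - ∑ β ∈ S, (holMonomial (polydisc z R) z β).1 w • taylorCoeff f z β ∈ U := by
  obtain ⟨V, hV, hVU⟩ := exists_nhds_zero_bipolar_subset hU
  obtain ⟨ρ, r, hρr, hKρ⟩ := exists_radii_of_isCompact hR hK
  have hr : ∀ k, 0 < r k := fun k => (hρr k).1.trans_lt (hρr k).2.1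
  have hzmem : z ∈ polydisc z R := fun k => by simpa using hR k
  let C : Set (Fin d → ℂ) := Set.univ.pi fun k => Metric.closedBall (z k) (r k)
  have hC : IsCompact C := isCompact_univ_pi fun k => isCompact_closedBall _ _
  have hCΩ : C ⊆ polydisc z R := by
    rw [coe_polydisc]
    exact Set.pi_mono fun k _ => (hρr k).2.2
  have hbdd := (hC.image_of_continuousOn ((continuousOn_zeroExt f.1).mono hCΩ)).isVonNBounded ℂ
  obtain ⟨M, hM, hMV⟩ := (hbdd hV).exists_pos
  have hsum : Summable fun β : Fin d → ℕ => M * ∏ k, (ρ k / r k) ^ β k :=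
    (summable_prod_pow (fun k => div_nonneg (hρr k).1 (hr k).le)
      fun k => (div_lt_one (hr k)).2 (hρr k).2.1).mul_left M
  obtain ⟨G, hG⟩ := hsum
  have hev : ∀ᶠ S : Finset (Fin d → ℕ) in atTop,
      G - ∑ β ∈ S, M * ∏ k, (ρ k / r k) ^ β k < 1 :=
    (tendsto_const_nhds.sub hG).eventually_lt_const (by simp)
  filter_upwards [hev] with S hS w hw
  refine hVU _ fun φ hφ => ?_
  have hscalar := cauchy_estimate_and_hasSum_taylor
    (U := fun k => Metric.eball (z k) (R k)) (fun k => Metric.isOpen_eball) hr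
    (fun k => (hρr k).2.2) (F := fun w => φ (zeroExt f.1 w)) (M := M)
    (fun v hv => by
      obtain ⟨y, hy, hyv⟩ := hMV (M : ℂ) (by simp [abs_of_pos hM])
        (Set.mem_image_of_mem _ (fun k _ => hv k : v ∈ C))
      simp only at hyv
      rw [← hyv, map_smul, smul_eq_mul, norm_mul, Complex.norm_real, Real.norm_eq_abs,
        abs_of_pos hM]
      exact mul_le_of_le_one_right hM.le (hφ y hy))
    (fun β => by
      rw [← coe_polydisc]
      exact (partialsExist_clm (polydisc z R).isOpen φ (fun w _ => rfl) _ (f.2.2 β)).1)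
  simp only [← map_taylorCoeff f hzmem] at hscalar
  have hexp := hscalar.2 w fun k => (hKρ w hw k).trans_lt (hρr k).2.1
  rw [zeroExt_of_mem _ w.2] at hexp
  have hrem := hexp.norm_sub_sum_le_of_bounded hG (fun β => ?_) S
  · rw [map_sub, map_sum]
    refine le_trans (le_of_eq ?_) (hrem.trans hS.le)
    simp [holMonomial, mul_comm]
  · have hpos : 0 < ∏ k, r k ^ β k := Finset.prod_pos fun k _ => pow_pos (hr k) _
    rw [norm_mul, norm_prod]
    simp only [norm_pow, div_pow, Finset.prod_div_distrib]
    rw [← mul_div_assoc, le_div_iff₀ hpos]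
    calc _ = (‖φ (taylorCoeff f z β)‖ * ∏ k, r k ^ β k) *
          ∏ k, ‖(w : Fin d → ℂ) k - z k‖ ^ β k := by ring
      _ ≤ M * ∏ k, ρ k ^ β k := by
        refine mul_le_mul (hscalar.1 β) (Finset.prod_le_prod (fun k _ => by positivity)
          fun k _ => pow_le_pow_left₀ (norm_nonneg _) ?_ _) (by positivity) hM.le
        rw [← dist_eq_norm]
        exact hKρ w hw k

theorem hasSum_taylor_polydisc [LocallyConvexSpace ℝ E] {z : Fin d → ℂ} {R : Fin d → ℝ≥0∞}
    (hR : ∀ k, 0 < R k) (f : HolSpace (polydisc z R) E) :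
    HasSum (fun β : Fin d → ℕ =>
      elemTensor (holMonomial (polydisc z R) z β) (taylorCoeff f z β)) f := by
  let _ : UniformSpace E := IsTopologicalAddGroup.rightUniformSpace E
  have : IsUniformAddGroup E := isUniformAddGroup_of_addCommGroup
  rw [HasSum, SummationFilter.unconditional_filter, tendsto_subtype_rng,
    ContinuousMap.tendsto_iff_forall_isCompact_tendstoUniformlyOn]
  intro K hK u hu
  rw [uniformity_eq_comap_nhds_zero_swapped] at hu
  obtain ⟨U, hU, hUu⟩ := hu
  filter_upwards [eventually_remainder_mem hR f hK hU] with S hS w hw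
  refine hUu ?_
  simpa using hS w hw

end Taylor

theorem mainTheorem4 {E : Type*} [AddCommGroup E] [Module ℂ E] [TopologicalSpace E]
    [IsTopologicalAddGroup E] [ContinuousSMul ℂ E] [LocallyConvexSpace ℝ E] [T2Space E]
    (hE : IsLocallyComplete E) {d : ℕ} (z : Fin d → ℂ) (R : Fin d → ℝ≥0∞) (hR : ∀ k, 0 < R k) :
    seqClosure (Set.range (tensorMap (polydisc z R) E)) = Set.univ ∧
      ∀ f : HolSpace (polydisc z R) E,
        HasSum (fun β : Fin d → ℕ =>
          elemTensor (holMonomial (polydisc z R) z β) (taylorCoeff f z β)) f := by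
  refine ⟨Set.eq_univ_of_forall fun f => ?_, fun f => hasSum_taylor_polydisc hR f⟩
  obtain ⟨S, hS⟩ := exists_seq_tendsto (atTop : Filter (Finset (Fin d → ℕ)))
  have hf := hasSum_taylor_polydisc hR f
  rw [HasSum, SummationFilter.unconditional_filter] at hf
  refine ⟨_, fun n => ?_, hf.comp hS⟩
  exact ⟨∑ β ∈ S n, holMonomial (polydisc z R) z β ⊗ₜ[ℂ] taylorCoeff f z β, by
    simp [tensorMap]⟩
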